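/- Let $(M,d)$ be a bounded metric space with a distinguished base point $0$, let $\tau$ be a topology on $M$ such that $(M,\tau)$ is compact and $d\colon (M,\tau)\times(M,\tau)\to\mathbb R$ is lower semicontinuous, and let $X$ be a real Banach space. For a real Banach space $Z$, let $Lip(M,Z)$ be the space of Lipschitz functions $f\colon M\to Z$ with $f(0)=0$, with the norm $$\|f\|=\sup\left\{\frac{\|f(x)-f(y)\|}{d(x,y)} : x,y\in M,\ x\neq y\right\},$$ and let $lip_\tau(M,Z)$ be the subspace of those $f\in Lip(M,Z)$ that are continuous from $\tau$ to the norm topology of $Z$ and satisfy $$\lim_{\varepsilon\to 0}\ \sup_{0<d(x,y)<\varepsilon}\frac{\|f(x)-f(y)\|}{d(x,y)}=0 .$$ Write $lip_\tau(M)=lip_\tau(M,\mathbb R)$. Let $K_{w^*,w}(X^*,lip_\tau(M))$ be the space of compact linear operators from $X^*$ to $lip_\tau(M)$ that are continuous from the weak-star topology of $X^*$ to the weak topology of $lip_\tau(M)$, with the operator norm. Then $lip_\tau(M,X)$ is linearly isometrically isomorphic to $K_{w^*,w}(X^*,lip_\tau(M))$. Moreover, if $lip_\tau(M)$ or $X$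 has the approximation property (a space $Y$ has it if for every compact $K\subseteq Y$ and every $\varepsilon>0$ there is a bounded finite-rank operator $S\colon Y\to Y$ with $\|y-S(y)\|<\varepsilon$ for all $y\in K$), then $lip_\tau(M,X)$ is linearly isometrically isomorphic to the injective tensor product $lip_\tau(M)\,\widehat{\otimes}_\varepsilon X$, the completion of $lip_\tau(M)\otimes X$ in the norm $\|u\|_\varepsilon=\sup\{|(\varphi\otimes\psi)(u)| : \varphi\in B_{lip_\tau(M)^*},\ \psi\in B_{X^*}\}$. -/

import Mathlib

open Set Filter Topology TensorProduct

set_option maxSynthPendingDepth 3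

noncomputable section

namespace LipTau

section Lipschitz

/-- The vector space underlying `Lip(M, X)`: Lipschitz maps `M → X` vanishing at the base
point `o`. -/
def lipSubmodule {M : Type*} [MetricSpace M] (o : M) (X : Type*) [NormedAddCommGroup X]
    [NormedSpace ℝ X] : Submodule ℝ (M → X) where
  carrier := {f | f o = 0 ∧ ∃ C : ℝ, ∀ x y, ‖f x - f y‖ ≤ C * dist x y}
  zero_mem' := ⟨rfl, 0, by simp⟩
  add_mem' := by
    rintro f g ⟨hf, C, hC⟩ ⟨hg, D, hD⟩
    refine ⟨by simp [hf, hg], C + D, fun x y => ?_⟩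
    have h : (f + g) x - (f + g) y = (f x - f y) + (g x - g y) := by
      simp only [Pi.add_apply]; abel
    rw [h, add_mul]
    exact (norm_add_le _ _).trans (add_le_add (hC x y) (hD x y))
  smul_mem' := by
    rintro c f ⟨hf, C, hC⟩
    refine ⟨by simp [hf], ‖c‖ * C, fun x y => ?_⟩
    rw [Pi.smul_apply, Pi.smul_apply, ← smul_sub, norm_smul, mul_assoc]
    exact mul_le_mul_of_nonneg_left (hC x y) (norm_nonneg _)

/-- The space `Lip(M, X)` of Lipschitz maps vanishing at `o`; it carries the Lipschitz norm. -/
def Lip {M : Type*} [MetricSpace M] (o : M) (X : Type*) [NormedAddCommGroup X]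
    [NormedSpace ℝ X] : Type _ :=
  ↥(lipSubmodule o X)

variable {M : Type*} [MetricSpace M] {o : M} {X : Type*} [NormedAddCommGroup X] [NormedSpace ℝ X]

instance : AddCommGroup (Lip o X) := inferInstanceAs (AddCommGroup ↥(lipSubmodule o X))

instance : Module ℝ (Lip o X) := inferInstanceAs (Module ℝ ↥(lipSubmodule o X))

instance : CoeFun (Lip o X) (fun _ => M → X) := ⟨fun f => f.1⟩

@[simp] theorem Lip.add_apply (f g : Lip o X) (x : M) : (f + g) x = f x + g x := rfl

@[simp] theorem Lip.neg_apply (f : Lip o X) (x : M) : (-f) x = -f x := rfl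

@[simp] theorem Lip.zero_apply (x : M) : (0 : Lip o X) x = 0 := rfl

@[simp] theorem Lip.smul_apply (c : ℝ) (f : Lip o X) (x : M) : (c • f) x = c • f x := rfl

@[ext] theorem Lip.ext {f g : Lip o X} (h : ∀ x, f x = g x) : f = g :=
  Subtype.ext (funext h)

/-- The Lipschitz norm, the supremum of `‖f x - f y‖ / d(x, y)` over `x ≠ y`
(a pair with `x = y` contributes `0 / 0 = 0`). -/
instance : Norm (Lip o X) :=
  ⟨fun f => ⨆ p : M × M, ‖f p.1 - f p.2‖ / dist p.1 p.2⟩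

theorem Lip.norm_def (f : Lip o X) :
    ‖f‖ = ⨆ p : M × M, ‖f p.1 - f p.2‖ / dist p.1 p.2 := rfl

theorem Lip.bddAbove (f : Lip o X) :
    BddAbove (range fun p : M × M => ‖f p.1 - f p.2‖ / dist p.1 p.2) := by
  obtain ⟨-, C, hC⟩ := f.2
  refine ⟨max C 0, ?_⟩
  rintro _ ⟨p, rfl⟩
  refine div_le_of_le_mul₀ dist_nonneg (le_max_right _ _) ((hC _ _).trans ?_)
  exact mul_le_mul_of_nonneg_right (le_max_left _ _) dist_nonneg

theorem Lip.norm_nonneg' (f : Lip o X) : 0 ≤ ‖f‖ :=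
  Real.iSup_nonneg fun _ => div_nonneg (norm_nonneg _) dist_nonneg

theorem Lip.norm_sub_le (f : Lip o X) (x y : M) : ‖f x - f y‖ ≤ ‖f‖ * dist x y := by
  rcases eq_or_ne x y with rfl | h
  · simp
  · exact (div_le_iff₀ (dist_pos.2 h)).1 (le_ciSup f.bddAbove (x, y))

theorem Lip.norm_le {f : Lip o X} {C : ℝ} (hC : 0 ≤ C)
    (h : ∀ x y, ‖f x - f y‖ ≤ C * dist x y) : ‖f‖ ≤ C := by
  have : Nonempty M := ⟨o⟩
  exact ciSup_le fun p => div_le_of_le_mul₀ dist_nonneg hC (h _ _)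

theorem Lip.norm_smul_le' (c : ℝ) (f : Lip o X) : ‖c • f‖ ≤ ‖c‖ * ‖f‖ := by
  refine Lip.norm_le (mul_nonneg (norm_nonneg _) f.norm_nonneg') fun x y => ?_
  rw [Lip.smul_apply, Lip.smul_apply, ← smul_sub, norm_smul, mul_assoc]
  exact mul_le_mul_of_nonneg_left (f.norm_sub_le x y) (norm_nonneg _)

instance : NormedAddCommGroup (Lip o X) :=
  AddGroupNorm.toNormedAddCommGroup
    { toFun := fun f => ‖f‖
      map_zero' := le_antisymm (Lip.norm_le le_rfl (by simp)) (Lip.norm_nonneg' _)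
      add_le' := fun f g => by
        refine Lip.norm_le (add_nonneg f.norm_nonneg' g.norm_nonneg') fun x y => ?_
        have h : (f + g) x - (f + g) y = (f x - f y) + (g x - g y) := by
          simp only [Lip.add_apply]; abel
        rw [h, add_mul]
        exact (norm_add_le _ _).trans (add_le_add (f.norm_sub_le x y) (g.norm_sub_le x y))
      neg' := fun f => by
        simp only [Lip.norm_def, Lip.neg_apply, neg_sub_neg]
        exact iSup_congr fun p => by rw [norm_sub_rev]
      eq_zero_of_map_eq_zero' := fun f hf => by
        ext x
        have h := f.norm_sub_le x o
        have h0 : f o = 0 := f.2.1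
        have hf' : ‖f‖ = 0 := hf
        rw [hf', h0, sub_zero, zero_mul] at h
        simpa using h }

instance : NormedSpace ℝ (Lip o X) where
  norm_smul_le := Lip.norm_smul_le'

variable (o X)

/-- `lip(M, X)`: the `f ∈ Lip(M, X)` such that the supremum of `‖f x - f y‖ / d(x, y)` over
`0 < d(x, y) < δ` tends to `0` as `δ → 0`. -/
def littleLip : Submodule ℝ (Lip o X) where
  carrier := {f | ∀ ε > 0, ∃ δ > 0, ∀ x y : M, 0 < dist x y → dist x y < δ →
    ‖f x - f y‖ / dist x y ≤ ε}
  zero_mem' := fun ε hε => ⟨1, one_pos, fun x y _ _ => by simpa using hε.le⟩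
  add_mem' := by
    intro f g hf hg ε hε
    obtain ⟨a, ha, hfa⟩ := hf (ε / 2) (half_pos hε)
    obtain ⟨b, hb, hgb⟩ := hg (ε / 2) (half_pos hε)
    refine ⟨min a b, lt_min ha hb, fun x y h0 h => ?_⟩
    have h1 := hfa x y h0 (h.trans_le (min_le_left _ _))
    have h2 := hgb x y h0 (h.trans_le (min_le_right _ _))
    have h3 : (f + g) x - (f + g) y = (f x - f y) + (g x - g y) := by
      simp only [Lip.add_apply]; abel
    rw [h3]
    calc ‖(f x - f y) + (g x - g y)‖ / dist x y
        ≤ (‖f x - f y‖ + ‖g x - g y‖) / dist x y :=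
          div_le_div_of_nonneg_right (norm_add_le _ _) h0.le
      _ ≤ ε := by rw [add_div]; linarith
  smul_mem' := by
    intro c f hf ε hε
    have hc : 0 < ‖c‖ + 1 := by positivity
    obtain ⟨a, ha, hfa⟩ := hf (ε / (‖c‖ + 1)) (div_pos hε hc)
    refine ⟨a, ha, fun x y h0 h => ?_⟩
    have h1 := hfa x y h0 h
    rw [Lip.smul_apply, Lip.smul_apply, ← smul_sub, norm_smul, mul_div_assoc]
    calc ‖c‖ * (‖f x - f y‖ / dist x y) ≤ (‖c‖ + 1) * (ε / (‖c‖ + 1)) :=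
          mul_le_mul (by linarith) h1 (div_nonneg (norm_nonneg _) h0.le) hc.le
      _ = ε := mul_div_cancel₀ _ hc.ne'

/-- The `f ∈ Lip(M, X)` that are continuous from the topology `τ` of `M` to the norm topology
of `X`. -/
def tauContinuous (τ : TopologicalSpace M) : Submodule ℝ (Lip o X) where
  carrier := {f | Continuous[τ, inferInstance] (f : M → X)}
  zero_mem' := @continuous_const M X τ _ 0
  add_mem' := fun {f _} (hf : Continuous[τ, inferInstance] (f : M → X)) hg =>
    @Continuous.add _ _ _ _ M τ _ _ hf hg
  smul_mem' := fun c f (hf : Continuous[τ, inferInstance] (f : M → X)) =>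
    @Continuous.const_smul _ _ _ _ _ _ τ _ hf c

/-- `lip_τ(M, X)`, with the Lipschitz norm inherited from `Lip(M, X)`. -/
def lipTau (τ : TopologicalSpace M) : Submodule ℝ (Lip o X) :=
  littleLip o X ⊓ tauContinuous o X τ

end Lipschitz

section Operators

/-- `K_{w*,w}(X*, Y)`: the compact operators `T : X* → Y` that are continuous from the weak-star
topology of `X*` to the weak topology of `Y`, with the operator norm. -/
def compactWeakStarWeak (X Y : Type*) [NormedAddCommGroup X] [NormedSpace ℝ X]
    [NormedAddCommGroup Y] [NormedSpace ℝ Y] : Submodule ℝ (StrongDual ℝ X →L[ℝ] Y) where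
  carrier := {T | IsCompactOperator T ∧
    Continuous fun φ : WeakDual ℝ X => toWeakSpace ℝ Y (T (WeakDual.toStrongDual φ))}
  zero_mem' := ⟨isCompactOperator_zero, by
    simpa using (continuous_const : Continuous fun _ : WeakDual ℝ X => (0 : WeakSpace ℝ Y))⟩
  add_mem' := by
    rintro S T ⟨hS, hS'⟩ ⟨hT, hT'⟩
    refine ⟨hS.add hT, ?_⟩
    simpa [Pi.add_def] using hS'.add hT'
  smul_mem' := by
    rintro c T ⟨hT, hT'⟩
    refine ⟨hT.smul c, ?_⟩
    simpa [Pi.smul_def] using hT'.const_smul c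

/-- The approximation property. -/
def HasAP (Y : Type*) [NormedAddCommGroup Y] [NormedSpace ℝ Y] : Prop :=
  ∀ K : Set Y, IsCompact K → ∀ ε > 0, ∃ S : Y →L[ℝ] Y,
    FiniteDimensional ℝ S.range ∧ ∀ y ∈ K, ‖y - S y‖ < ε

end Operators

section InjectiveTensor

variable (Y X : Type*) [NormedAddCommGroup Y] [NormedSpace ℝ Y] [NormedAddCommGroup X]
  [NormedSpace ℝ X]

/-- The canonical map from `Y ⊗ X` to the bounded bilinear forms on `Y* × X*`, sending `y ⊗ x`
to `(φ, ψ) ↦ φ y * ψ x`. -/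
def tensorToBilin : Y ⊗[ℝ] X →ₗ[ℝ] StrongDual ℝ Y →L[ℝ] StrongDual ℝ X →L[ℝ] ℝ :=
  TensorProduct.lift <| LinearMap.mk₂ ℝ
    (fun y x => (NormedSpace.inclusionInDoubleDual ℝ Y y).smulRight
      (NormedSpace.inclusionInDoubleDual ℝ X x))
    (fun _ _ _ => by ext; simp [add_mul]) (fun _ _ _ => by ext; simp [mul_assoc])
    (fun _ _ _ => by ext; simp) (fun _ _ _ => by ext; simp [mul_left_comm])

theorem tensorToBilin_tmul (y : Y) (x : X) (φ : StrongDual ℝ Y) (ψ : StrongDual ℝ X) :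
    tensorToBilin Y X (y ⊗ₜ[ℝ] x) φ ψ = φ y * ψ x := by
  simp [tensorToBilin]

/-- The algebraic tensor product `Y ⊗ X`, to be given the injective norm. -/
def AlgTensor : Type _ := Y ⊗[ℝ] X

instance : AddCommGroup (AlgTensor Y X) := inferInstanceAs (AddCommGroup (Y ⊗[ℝ] X))

instance : Module ℝ (AlgTensor Y X) := inferInstanceAs (Module ℝ (Y ⊗[ℝ] X))

/-- The injective norm: `‖u‖` is the norm of `u` as a bilinear form on `Y* × X*`, that is, the
supremum of `|(φ ⊗ ψ) u|` over `φ` and `ψ` in the closed unit balls of `Y*` and `X*`. -/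
instance : SeminormedAddCommGroup (AlgTensor Y X) :=
  SeminormedAddCommGroup.induced (AlgTensor Y X) _
    (show AlgTensor Y X →ₗ[ℝ] StrongDual ℝ Y →L[ℝ] StrongDual ℝ X →L[ℝ] ℝ from tensorToBilin Y X)

instance : NormedSpace ℝ (AlgTensor Y X) :=
  NormedSpace.induced ℝ (AlgTensor Y X) _
    (show AlgTensor Y X →ₗ[ℝ] StrongDual ℝ Y →L[ℝ] StrongDual ℝ X →L[ℝ] ℝ from tensorToBilin Y X)

/-- The injective tensor product, the completion of `Y ⊗ X` in the injective norm. -/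
abbrev InjectiveTensor : Type _ := UniformSpace.Completion (AlgTensor Y X)

end InjectiveTensor

end LipTau

end

/-! A map `f` corresponds to the operator `toOp f`, `φ ↦ φ ∘ f`; Hahn–Banach makes this isometric.
The range of `f` is norm compact and close pairs contribute little to the Lipschitz norm, so `φ ∘ f`
is small once `φ` is bounded and small on a finite net of the range (`exists_norm_toOp_le`). Thus
`toOp f` is weak-star-to-norm continuous on balls: Banach–Alaoglu gives compactness, and
completeness of `X` turns each `l ∘ toOp f` into evaluation at a point of `X`, which is
weak-star-to-weak continuity.

Conversely (`exists_toOp_eq`), `φ ↦ T φ x` is weak-star continuous, hence evaluation at some `f x`;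
total boundedness of the image of the dual ball makes the regularity of the `φ ∘ f` uniform in `φ`,
so it passes to `f`.

The injective norm on the algebraic tensor product is the operator norm of the associated `toOp`, so
`tensorMap` is isometric. The approximation property makes its range dense, and both sides are
completions of the same space. -/

namespace LipTau

/-! ### Functionals on `X*` given by points of `X`. -/

section DoubleDual

variable {X : Type*} [NormedAddCommGroup X] [NormedSpace ℝ X] [CompleteSpace X]

/-- A functional on `X*` which is small on the part of the unit ball lying in the annihilator of
a finite subset of `X` is the evaluation at a point of `X`. -/
theorem exists_eq_eval_of_small_on_annihilator (F : StrongDual ℝ (StrongDual ℝ X))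
    (h : ∀ ε > 0, ∃ s : Finset X, ∀ φ : StrongDual ℝ X, ‖φ‖ ≤ 1 → (∀ x ∈ s, φ x = 0) →
      ‖F φ‖ ≤ ε) :
    ∃ x : X, ∀ φ, F φ = φ x := by
  have hcl : IsClosed (range (NormedSpace.inclusionInDoubleDualLi ℝ (E := X))) :=
    (NormedSpace.inclusionInDoubleDualLi ℝ (E := X)).isometry.isClosedEmbedding.isClosed_range
  have hmem : F ∈ range (NormedSpace.inclusionInDoubleDualLi ℝ (E := X)) := by
    rw [← hcl.closure_eq, Metric.mem_closure_range_iff]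
    intro ε hε
    obtain ⟨s, hs⟩ := h (ε / 2) (half_pos hε)
    let N : Submodule ℝ (StrongDual ℝ X) :=
      ⨅ x : s, (NormedSpace.inclusionInDoubleDual ℝ X x).ker
    -- `G` extends the small restriction `F|N` without increasing its norm. Then `F - G` vanishes on
    -- `N`, a finite intersection of kernels of evaluations, so it is a combination of those
    -- evaluations: `F` is within `ε` of a point of `X`.
    obtain ⟨G, hG, hGn⟩ := _root_.exists_extension_norm_eq N (F.comp N.subtypeL)
    have hn : ‖F.comp N.subtypeL‖ ≤ ε / 2 := by
      refine ContinuousLinearMap.opNorm_le_of_unit_norm (half_pos hε).le fun φ hφ => ?_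
      refine hs φ (by simpa using hφ.le) fun x hx => ?_
      have := φ.2
      simp only [N, Submodule.mem_iInf] at this
      exact this ⟨x, hx⟩
    have hspan : (F - G).toLinearMap ∈ Submodule.span ℝ
        (range fun x : s => (NormedSpace.inclusionInDoubleDual ℝ X x).toLinearMap) := by
      refine mem_span_of_iInf_ker_le_ker fun φ hφ => ?_
      have := hG ⟨φ, hφ⟩
      simp only [ContinuousLinearMap.comp_apply, Submodule.subtypeL_apply] at this
      simp [this]
    obtain ⟨c, hc⟩ := (Submodule.mem_span_range_iff_exists_fun ℝ).1 hspan
    refine ⟨∑ i, c i • (i : X), ?_⟩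
    have : F - NormedSpace.inclusionInDoubleDualLi ℝ (∑ i, c i • (i : X)) = G := by
      ext φ
      have := LinearMap.congr_fun hc φ
      simp only [LinearMap.sum_apply, LinearMap.smul_apply, ContinuousLinearMap.coe_coe,
        NormedSpace.dual_def, _root_.sub_apply] at this
      have h2 : NormedSpace.inclusionInDoubleDualLi ℝ (∑ i, c i • (i : X)) φ
          = ∑ i, c i • φ (i : X) := by
        change φ (∑ i, c i • (i : X)) = _
        simp
      rw [_root_.sub_apply, h2, this]
      ring
    rw [dist_eq_norm, this, hGn]
    linarith
  obtain ⟨x, rfl⟩ := hmem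
  exact ⟨x, fun φ => rfl⟩

/-- A linear functional on `X*` that is weak-star continuous is the evaluation at a point. -/
theorem exists_eq_eval_of_continuous {X : Type*} [NormedAddCommGroup X] [NormedSpace ℝ X]
    (F : StrongDual ℝ X →ₗ[ℝ] ℝ)
    (h : Continuous fun φ : WeakDual ℝ X => F (WeakDual.toStrongDual φ)) :
    ∃ x : X, ∀ φ, F φ = φ x := by
  let G : StrongDual ℝ (WeakBilin (topDualPairing ℝ X)) :=
    { toLinearMap := F ∘ₗ (WeakDual.toStrongDual (𝕜 := ℝ) (E := X)).toLinearMap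
      cont := h }
  obtain ⟨x, hx⟩ := LinearMap.dualEmbedding_surjective (topDualPairing ℝ X) G
  exact ⟨x, fun φ => (DFunLike.congr_fun hx (StrongDual.toWeakDual φ)).symm⟩

end DoubleDual

/-! ### The spaces of Lipschitz maps: closedness, completeness and the operator `φ ↦ φ ∘ f`. -/

section Basic

variable {M : Type*} [MetricSpace M] {o : M} {X : Type*} [NormedAddCommGroup X] [NormedSpace ℝ X]
  {Z : Type*} [NormedAddCommGroup Z] [NormedSpace ℝ Z] {τ : TopologicalSpace M}

@[simp] theorem Lip.sub_apply (f g : Lip o X) (x : M) : (f - g) x = f x - g x := rfl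

theorem Lip.apply_base (f : Lip o X) : f o = 0 := f.2.1

theorem Lip.norm_apply_le (f : Lip o X) (x : M) : ‖f x‖ ≤ ‖f‖ * dist x o := by
  simpa [f.apply_base] using f.norm_sub_le x o

theorem mem_littleLip_iff {f : Lip o X} : f ∈ littleLip o X ↔
    ∀ ε > 0, ∃ δ > 0, ∀ x y : M, dist x y < δ → ‖f x - f y‖ ≤ ε * dist x y := by
  refine forall₂_congr fun ε hε => exists_congr fun δ => and_congr_right fun hδ =>
    forall₂_congr fun x y => ?_
  constructor
  · intro h hd
    rcases eq_or_ne x y with rfl | hne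
    · simp
    · exact (div_le_iff₀ (dist_pos.2 hne)).1 (h (dist_pos.2 hne) hd)
  · intro h h0 hd
    exact (div_le_iff₀ h0).2 (h hd)

theorem mem_tauContinuous_iff {f : Lip o X} : f ∈ tauContinuous o X τ ↔
    ∀ x, ∀ ε > 0, ∀ᶠ y in @nhds M τ x, ‖f y - f x‖ < ε := by
  change (@Continuous M X τ _ f) ↔ _
  let := τ
  simp only [@continuous_iff_continuousAt M X τ, ContinuousAt, Metric.tendsto_nhds, dist_eq_norm]

theorem exists_dist_le [BoundedSpace M] : ∃ D : ℝ, 0 < D ∧ ∀ x y : M, dist x y ≤ D :=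
  ⟨Metric.diam (univ : Set M) + 1, by positivity, fun x y =>
    (Metric.dist_le_diam_of_mem (BoundedSpace.bounded_univ) (mem_univ x) (mem_univ y)).trans
      (by linarith)⟩

/-- Boundedness of `d` is what lets τ-continuity survive limits in Lipschitz norm: such limits are
then uniform. -/
theorem mem_lipTau_of_approx [BoundedSpace M] {f : Lip o X}
    (h : ∀ ε > 0, ∃ g ∈ lipTau o X τ, ‖f - g‖ ≤ ε) : f ∈ lipTau o X τ := by
  have key : ∀ (g : Lip o X) (x y : M), ‖f x - f y‖ ≤ ‖f - g‖ * dist x y + ‖g x - g y‖ := by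
    intro g x y
    have h3 : f x - f y = ((f - g) x - (f - g) y) + (g x - g y) := by
      simp only [Lip.sub_apply]; abel
    rw [h3]
    exact (norm_add_le _ _).trans (by linarith [(f - g).norm_sub_le x y])
  refine ⟨mem_littleLip_iff.2 fun ε hε => ?_, mem_tauContinuous_iff.2 fun x ε hε => ?_⟩
  · obtain ⟨g, hg, hfg⟩ := h (ε / 2) (half_pos hε)
    obtain ⟨δ, hδ, H⟩ := mem_littleLip_iff.1 hg.1 (ε / 2) (half_pos hε)
    refine ⟨δ, hδ, fun x y hxy => ?_⟩
    have h2 := mul_le_mul_of_nonneg_right hfg (dist_nonneg (x := x) (y := y))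
    linarith [key g x y, H x y hxy]
  · obtain ⟨D, hD, hd⟩ := exists_dist_le (M := M)
    obtain ⟨g, hg, hfg⟩ := h (ε / (2 * D)) (by positivity)
    filter_upwards [mem_tauContinuous_iff.1 hg.2 x (ε / 2) (half_pos hε)] with y hy
    have h2 : ‖f - g‖ * dist y x ≤ ε / (2 * D) * D :=
      mul_le_mul hfg (hd y x) dist_nonneg (by positivity)
    have h3 : ε / (2 * D) * D = ε / 2 := by field_simp
    linarith [key g y x]

theorem isClosed_lipTau [BoundedSpace M] : IsClosed (lipTau o X τ : Set (Lip o X)) := by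
  refine isClosed_of_closure_subset fun f hf => mem_lipTau_of_approx fun ε hε => ?_
  obtain ⟨g, hg, hfg⟩ := Metric.mem_closure_iff.1 hf ε hε
  exact ⟨g, hg, by simpa [dist_eq_norm] using hfg.le⟩

/-- Evaluation at a point, as a bounded operator. -/
noncomputable def Lip.eval (x : M) : Lip o X →L[ℝ] X :=
  LinearMap.mkContinuous
    { toFun := fun f => f x
      map_add' := fun _ _ => rfl
      map_smul' := fun _ _ => rfl } (dist x o) fun f => by
    rw [mul_comm]
    exact f.norm_apply_le x

instance [CompleteSpace X] : CompleteSpace (Lip o X) := by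
  refine Metric.complete_of_cauchySeq_tendsto fun u hu => ?_
  have hc : ∀ x, ∃ z, Tendsto (fun n => u n x) atTop (𝓝 z) := fun x =>
    cauchySeq_tendsto_of_complete (hu.map (Lip.eval (o := o) (X := X) x).uniformContinuous)
  choose f hf using hc
  have key : ∀ ε > 0, ∃ N, ∀ n ≥ N, ∀ x y,
      ‖(f x - f y) - (u n x - u n y)‖ ≤ ε * dist x y := by
    intro ε hε
    obtain ⟨N, hN⟩ := Metric.cauchySeq_iff.1 hu ε hε
    refine ⟨N, fun n hn x y => ?_⟩
    refine le_of_tendsto (((hf x).sub (hf y)).sub_const _).norm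
      ((eventually_ge_atTop N).mono fun m hm => ?_)
    have h1 := (u m - u n).norm_sub_le x y
    have h2 : ‖u m - u n‖ ≤ ε := by simpa [dist_eq_norm] using (hN m hm n hn).le
    have h3 : (u m x - u m y) - (u n x - u n y) = (u m - u n) x - (u m - u n) y := by
      simp only [Lip.sub_apply]; abel
    rw [h3]
    exact h1.trans (mul_le_mul_of_nonneg_right h2 dist_nonneg)
  have hmem : f ∈ lipSubmodule o X := by
    refine ⟨tendsto_nhds_unique (hf o) (by simp [Lip.apply_base]), ?_⟩
    obtain ⟨N, hN⟩ := key 1 one_pos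
    refine ⟨1 + ‖u N‖, fun x y => ?_⟩
    have h1 := norm_add_le ((f x - f y) - (u N x - u N y)) (u N x - u N y)
    rw [sub_add_cancel] at h1
    linarith [hN N le_rfl x y, (u N).norm_sub_le x y]
  let g : Lip o X := ⟨f, hmem⟩
  refine ⟨g, Metric.tendsto_atTop.2 fun ε hε => ?_⟩
  obtain ⟨N, hN⟩ := key (ε / 2) (half_pos hε)
  refine ⟨N, fun n hn => ?_⟩
  rw [dist_comm, dist_eq_norm]
  refine (Lip.norm_le (half_pos hε).le fun x y => ?_).trans_lt (half_lt_self hε)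
  have h3 : (f x - u n x) - (f y - u n y) = (f x - f y) - (u n x - u n y) := by abel
  exact (congrArg norm h3).trans_le (hN n hn x y)

instance [BoundedSpace M] [CompleteSpace X] : CompleteSpace (lipTau o X τ) :=
  isClosed_lipTau.completeSpace_coe

/-- Composition of a Lipschitz map with a bounded operator. -/
def Lip.postcomp (A : X →L[ℝ] Z) : Lip o X →ₗ[ℝ] Lip o Z where
  toFun f := ⟨fun x => A (f x), by simp [f.apply_base], ‖A‖ * ‖f‖, fun x y => by
    rw [← map_sub, mul_assoc]
    exact (A.le_opNorm _).trans
      (mul_le_mul_of_nonneg_left (f.norm_sub_le x y) (norm_nonneg _))⟩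
  map_add' f g := Lip.ext fun x => map_add A _ _
  map_smul' c f := Lip.ext fun x => map_smul A _ _

@[simp] theorem Lip.postcomp_apply (A : X →L[ℝ] Z) (f : Lip o X) (x : M) :
    Lip.postcomp A f x = A (f x) := rfl

theorem Lip.norm_postcomp_le (A : X →L[ℝ] Z) (f : Lip o X) :
    ‖Lip.postcomp A f‖ ≤ ‖A‖ * ‖f‖ :=
  Lip.norm_le (by have := f.norm_nonneg'; positivity) fun x y => by
    rw [Lip.postcomp_apply, Lip.postcomp_apply, ← map_sub, mul_assoc]
    exact (A.le_opNorm _).trans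
      (mul_le_mul_of_nonneg_left (f.norm_sub_le x y) (norm_nonneg _))

theorem Lip.postcomp_mem (A : X →L[ℝ] Z) {f : Lip o X} (hf : f ∈ lipTau o X τ) :
    Lip.postcomp A f ∈ lipTau o Z τ := by
  refine ⟨mem_littleLip_iff.2 fun ε hε => ?_, ?_⟩
  · have hA : 0 < ‖A‖ + 1 := by positivity
    obtain ⟨δ, hδ, H⟩ := mem_littleLip_iff.1 hf.1 (ε / (‖A‖ + 1)) (by positivity)
    refine ⟨δ, hδ, fun x y hxy => ?_⟩
    rw [Lip.postcomp_apply, Lip.postcomp_apply, ← map_sub]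
    calc ‖A (f x - f y)‖ ≤ ‖A‖ * ‖f x - f y‖ := A.le_opNorm _
      _ ≤ (‖A‖ + 1) * (ε / (‖A‖ + 1) * dist x y) :=
        mul_le_mul (by linarith) (H x y hxy) (norm_nonneg _) hA.le
      _ = ε * dist x y := by field_simp
  · exact @Continuous.comp M X Z τ _ _ _ _ A.continuous hf.2

/-- The operator `X* → lip_τ(M)`, `φ ↦ φ ∘ f`, associated with `f ∈ lip_τ(M, X)`. -/
noncomputable def toOp (f : lipTau o X τ) : StrongDual ℝ X →L[ℝ] lipTau o ℝ τ :=
  LinearMap.mkContinuous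
    { toFun := fun φ => ⟨Lip.postcomp φ f.1, Lip.postcomp_mem φ f.2⟩
      map_add' := fun _ _ => rfl
      map_smul' := fun _ _ => rfl } ‖f‖ fun φ => by
    rw [mul_comm]
    exact Lip.norm_postcomp_le φ f.1

/-- Here `f` is a bare function, so the bound serves both for the isometry and for showing that the
map reconstructed from an operator is Lipschitz. -/
theorem norm_sub_le_of_eq_comp (S : StrongDual ℝ X →L[ℝ] lipTau o ℝ τ) (f : M → X)
    (h : ∀ φ x, (S φ).1 x = φ (f x)) (x y : M) : ‖f x - f y‖ ≤ ‖S‖ * dist x y := by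
  refine NormedSpace.norm_le_dual_bound ℝ _ (by positivity) fun φ => ?_
  rw [map_sub, ← h, ← h]
  refine ((S φ).1.norm_sub_le x y).trans ?_
  have h1 : ‖(S φ).1‖ ≤ ‖S‖ * ‖φ‖ := S.le_opNorm φ
  calc ‖(S φ).1‖ * dist x y ≤ (‖S‖ * ‖φ‖) * dist x y :=
        mul_le_mul_of_nonneg_right h1 dist_nonneg
    _ = _ := by ring

theorem norm_toOp (f : lipTau o X τ) : ‖toOp f‖ = ‖f‖ :=
  le_antisymm (LinearMap.mkContinuous_norm_le _ (norm_nonneg _) _)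
    (Lip.norm_le (norm_nonneg _) (norm_sub_le_of_eq_comp _ _ fun _ _ => rfl))

end Basic

/-! ### Identification with the compact weak-star-to-weak operators. -/

section Operators

variable {M : Type*} [MetricSpace M] {o : M} {X : Type*} [NormedAddCommGroup X] [NormedSpace ℝ X]
  {τ : TopologicalSpace M}

theorem isCompact_range_of_mem_lipTau (hc : @CompactSpace M τ) (f : lipTau o X τ) :
    IsCompact (range (f.1 : M → X)) :=
  @isCompact_range M X τ _ hc _ f.2.2

/-- On bounded sets, `toOp f` is continuous at `0` from the weak-star topology to the norm. -/
theorem exists_norm_toOp_le (hc : @CompactSpace M τ) (f : lipTau o X τ) (R : ℝ) {ε : ℝ}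
    (hε : 0 < ε) : ∃ s : Finset X, ∃ η > 0, ∀ φ : StrongDual ℝ X, ‖φ‖ ≤ R →
      (∀ x ∈ s, ‖φ x‖ ≤ η) → ‖toOp f φ‖ ≤ ε := by
  wlog hR : 0 < R generalizing R
  · obtain ⟨s, η, hη, H⟩ := this 1 one_pos
    exact ⟨s, η, hη, fun φ hφ => H φ (by linarith)⟩
  obtain ⟨δ, hδ, hf⟩ := mem_littleLip_iff.1 f.2.1 (ε / R) (by positivity)
  -- The net radius and `η` each contribute `ε * δ / 4` to `‖φ (f x)‖`. Two such values differ by at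
  -- most `ε * δ`, hence by at most `ε * dist x y` when `dist x y ≥ δ`; closer pairs use the
  -- little-Lipschitz bound.
  obtain ⟨t, ht, hcov⟩ := Metric.totallyBounded_iff.1
    (isCompact_range_of_mem_lipTau hc f).totallyBounded (ε * δ / (4 * R)) (by positivity)
  refine ⟨ht.toFinset, ε * δ / 4, by positivity, fun φ hφ hs => ?_⟩
  have hbd : ∀ x, ‖φ (f.1 x)‖ ≤ ε * δ / 2 := by
    intro x
    obtain ⟨z, hz, hxz⟩ := mem_iUnion₂.1 (hcov (mem_range_self x))
    have h1 : ‖φ (f.1 x - z)‖ ≤ R * (ε * δ / (4 * R)) :=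
      (φ.le_opNorm _).trans (mul_le_mul hφ ((dist_eq_norm (f.1 x) z).symm.trans_le (Metric.mem_ball.1 hxz).le)
        (norm_nonneg _) hR.le)
    have h2 : R * (ε * δ / (4 * R)) = ε * δ / 4 := by field_simp
    have h3 := hs z (by simpa using hz)
    have h4 : φ (f.1 x) = φ (f.1 x - z) + φ z := by simp
    rw [h4]
    linarith [norm_add_le (φ (f.1 x - z)) (φ z)]
  refine Lip.norm_le hε.le fun x y => ?_
  change ‖φ (f.1 x) - φ (f.1 y)‖ ≤ ε * dist x y
  rcases lt_or_ge (dist x y) δ with hd | hd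
  · rw [← map_sub]
    calc ‖φ (f.1 x - f.1 y)‖ ≤ ‖φ‖ * ‖f.1 x - f.1 y‖ := φ.le_opNorm _
      _ ≤ R * (ε / R * dist x y) := mul_le_mul hφ (hf x y hd) (norm_nonneg _) hR.le
      _ = ε * dist x y := by field_simp
  · have := mul_le_mul_of_nonneg_left hd hε.le
    linarith [norm_sub_le (φ (f.1 x)) (φ (f.1 y)), hbd x, hbd y]

theorem isCompactOperator_toOp (hc : @CompactSpace M τ) (f : lipTau o X τ) :
    IsCompactOperator (toOp f) := by
  let B : Set (WeakDual ℝ X) := WeakDual.toStrongDual ⁻¹' Metric.closedBall 0 1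
  have hB : IsCompact B := WeakDual.isCompact_closedBall 0 1
  have hcont : ContinuousOn (fun φ : WeakDual ℝ X => toOp f (WeakDual.toStrongDual φ)) B := by
    intro φ₀ hφ₀
    refine Metric.tendsto_nhds.2 fun ε hε => ?_
    -- Radius 2 accommodates the difference of two elements of the unit ball.
    obtain ⟨s, η, hη, H⟩ := exists_norm_toOp_le hc f 2 (half_pos hε)
    have hev : ∀ᶠ φ : WeakDual ℝ X in 𝓝 φ₀, ∀ x ∈ s, dist (φ x) (φ₀ x) < η :=
      (Filter.eventually_all_finset s).2 fun x _ =>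
        Metric.tendsto_nhds.1 (WeakDual.eval_continuous x).continuousAt η hη
    filter_upwards [nhdsWithin_le_nhds hev, self_mem_nhdsWithin] with φ hφ hφB
    rw [dist_eq_norm, ← map_sub]
    refine (H _ ?_ fun x hx => ?_).trans_lt (half_lt_self hε)
    · have h1 : ‖WeakDual.toStrongDual φ‖ ≤ 1 := by simpa [B] using hφB
      have h2 : ‖WeakDual.toStrongDual φ₀‖ ≤ 1 := by simpa [B] using hφ₀
      exact (norm_sub_le _ _).trans (by linarith)
    · exact (hφ x hx).le
  refine (isCompactOperator_iff_image_closedBall_subset_compact (toOp f).toLinearMap one_pos).2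
    ⟨_, hB.image_of_continuousOn hcont, ?_⟩
  rintro _ ⟨φ, hφ, rfl⟩
  exact ⟨StrongDual.toWeakDual φ, hφ, rfl⟩

/-- Every functional composed with `toOp f` is the evaluation at a point of `X`. -/
theorem exists_apply_toOp_eq [CompleteSpace X] (hc : @CompactSpace M τ) (f : lipTau o X τ)
    (l : StrongDual ℝ (lipTau o ℝ τ)) : ∃ x : X, ∀ φ, l (toOp f φ) = φ x := by
  refine exists_eq_eval_of_small_on_annihilator (l.comp (toOp f)) fun ε hε => ?_
  obtain ⟨s, η, hη, H⟩ := exists_norm_toOp_le hc f 1 (ε := ε / (‖l‖ + 1)) (by positivity)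
  refine ⟨s, fun φ hφ hs => ?_⟩
  have h1 := H φ hφ fun x hx => by simpa [hs x hx] using hη.le
  calc ‖l (toOp f φ)‖ ≤ ‖l‖ * ‖toOp f φ‖ := l.le_opNorm _
    _ ≤ (‖l‖ + 1) * (ε / (‖l‖ + 1)) :=
      mul_le_mul (by linarith) h1 (norm_nonneg _) (by positivity)
    _ = ε := by field_simp

theorem toOp_mem [CompleteSpace X] (hc : @CompactSpace M τ) (f : lipTau o X τ) :
    toOp f ∈ compactWeakStarWeak X (lipTau o ℝ τ) := by
  refine ⟨isCompactOperator_toOp hc f, WeakBilin.continuous_of_continuous_eval _ fun l => ?_⟩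
  obtain ⟨x, hx⟩ := exists_apply_toOp_eq hc f l
  exact (WeakDual.eval_continuous x).congr fun φ => (hx (WeakDual.toStrongDual φ)).symm

/-- One `δ` works for a finite `ε / 2`-net, and the remaining error is itself `ε / 2`-Lipschitz. -/
theorem littleLip_of_totallyBounded {A : Set (lipTau o X τ)} (hA : TotallyBounded A) {ε : ℝ}
    (hε : 0 < ε) : ∃ δ > 0, ∀ g ∈ A, ∀ x y : M, dist x y < δ →
      ‖g.1 x - g.1 y‖ ≤ ε * dist x y := by
  obtain ⟨t, ht, hcov⟩ := Metric.totallyBounded_iff.1 hA (ε / 2) (half_pos hε)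
  have hg : ∀ h : lipTau o X τ, ∀ᶠ δ in 𝓝[>] (0 : ℝ), ∀ x y : M, dist x y < δ →
      ‖h.1 x - h.1 y‖ ≤ ε / 2 * dist x y := by
    intro h
    obtain ⟨δ, hδ, H⟩ := mem_littleLip_iff.1 h.2.1 (ε / 2) (half_pos hε)
    filter_upwards [Ioo_mem_nhdsGT hδ] with δ' hδ' x y hxy
    exact H x y (hxy.trans hδ'.2)
  obtain ⟨δ, H, hδ⟩ := (((Filter.eventually_all_finite ht).2 fun h _ => hg h).and
    self_mem_nhdsWithin).exists
  refine ⟨δ, hδ, fun g hgA x y hxy => ?_⟩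
  obtain ⟨h, hh, hgh⟩ := mem_iUnion₂.1 (hcov hgA)
  have h1 : ‖g.1 - h.1‖ ≤ ε / 2 := by
    have : dist g h < ε / 2 := hgh
    rw [dist_eq_norm] at this
    exact this.le
  have h2 := ((g.1 - h.1).norm_sub_le x y).trans (mul_le_mul_of_nonneg_right h1 dist_nonneg)
  have h3 : g.1 x - g.1 y = ((g.1 - h.1) x - (g.1 - h.1) y) + (h.1 x - h.1 y) := by
    simp only [Lip.sub_apply]; abel
  rw [h3]
  linarith [norm_add_le ((g.1 - h.1) x - (g.1 - h.1) y) (h.1 x - h.1 y), H h hh x y hxy]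

theorem equicontinuous_of_totallyBounded [BoundedSpace M] {A : Set (lipTau o X τ)}
    (hA : TotallyBounded A) (x : M) {ε : ℝ} (hε : 0 < ε) :
    ∀ᶠ y in @nhds M τ x, ∀ g ∈ A, ‖g.1 y - g.1 x‖ ≤ ε := by
  obtain ⟨D, hD, hd⟩ := exists_dist_le (M := M)
  obtain ⟨t, ht, hcov⟩ := Metric.totallyBounded_iff.1 hA (ε / (2 * D)) (by positivity)
  filter_upwards [(Filter.eventually_all_finite ht).2 fun h _ =>
    mem_tauContinuous_iff.1 h.2.2 x (ε / 2) (half_pos hε)] with y H g hgA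
  obtain ⟨h, hh, hgh⟩ := mem_iUnion₂.1 (hcov hgA)
  have h1 : ‖g.1 - h.1‖ ≤ ε / (2 * D) := by
    have : dist g h < ε / (2 * D) := hgh
    rw [dist_eq_norm] at this
    exact this.le
  have h2 := ((g.1 - h.1).norm_sub_le y x).trans
    (mul_le_mul h1 (hd y x) dist_nonneg (by positivity))
  have h3 : g.1 y - g.1 x = ((g.1 - h.1) y - (g.1 - h.1) x) + (h.1 y - h.1 x) := by
    simp only [Lip.sub_apply]; abel
  have h4 : ε / (2 * D) * D = ε / 2 := by field_simp
  rw [h3]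
  linarith [norm_add_le ((g.1 - h.1) y - (g.1 - h.1) x) (h.1 y - h.1 x), H h hh]

theorem norm_le_of_unit_dual (x : X) {C : ℝ}
    (h : ∀ φ : StrongDual ℝ X, ‖φ‖ ≤ 1 → ‖φ x‖ ≤ C) : ‖x‖ ≤ C := by
  obtain ⟨φ, hφ, hx⟩ := exists_dual_vector'' ℝ x
  simpa [hx] using h φ hφ

theorem exists_toOp_eq [BoundedSpace M] {T : StrongDual ℝ X →L[ℝ] lipTau o ℝ τ}
    (hT : T ∈ compactWeakStarWeak X (lipTau o ℝ τ)) : ∃ f : lipTau o X τ, toOp f = T := by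
  obtain ⟨hTc, hTw⟩ := hT
  have hev : ∀ x : M, ∃ z : X, ∀ φ, (T φ).1 x = φ z := by
    intro x
    -- Point evaluations are bounded functionals, so weak continuity of `T` can be tested on them.
    let l : StrongDual ℝ (lipTau o ℝ τ) := (Lip.eval x).comp (lipTau o ℝ τ).subtypeL
    exact exists_eq_eval_of_continuous (l.comp T).toLinearMap
      ((WeakBilin.eval_continuous (topDualPairing ℝ (lipTau o ℝ τ)).flip l).comp hTw)
  choose f hf using hev
  obtain ⟨K, hK, hKT⟩ := hTc.image_closedBall_subset_compact (f := T.toLinearMap) 1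
  have hmem : ∀ φ : StrongDual ℝ X, ‖φ‖ ≤ 1 → T φ ∈ K := fun φ hφ =>
    hKT ⟨φ, by simpa using hφ, rfl⟩
  have hLip : f ∈ lipSubmodule o X :=
    ⟨(SeparatingDual.eq_zero_iff_forall_dual_eq_zero (R := ℝ) _).2 fun φ => by
      rw [← hf, Lip.apply_base], ‖T‖, norm_sub_le_of_eq_comp T f fun φ x => hf x φ⟩
  let F : Lip o X := ⟨f, hLip⟩
  have hF : F ∈ lipTau o X τ := by
    refine ⟨mem_littleLip_iff.2 fun ε hε => ?_, mem_tauContinuous_iff.2 fun x ε hε => ?_⟩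
    · obtain ⟨δ, hδ, H⟩ := littleLip_of_totallyBounded hK.totallyBounded hε
      refine ⟨δ, hδ, fun x y hxy => norm_le_of_unit_dual _ fun φ hφ => ?_⟩
      have := H _ (hmem φ hφ) x y hxy
      rwa [hf, hf, ← map_sub] at this
    · filter_upwards [equicontinuous_of_totallyBounded hK.totallyBounded x (half_pos hε)]
        with y hy
      refine (norm_le_of_unit_dual _ fun φ hφ => ?_).trans_lt (half_lt_self hε)
      have := hy _ (hmem φ hφ)
      rwa [hf, hf, ← map_sub] at this
  refine ⟨⟨F, hF⟩, ?_⟩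
  exact ContinuousLinearMap.ext fun φ => Subtype.ext (Lip.ext fun x => (hf x φ).symm)

/-- `lip_τ(M, X)` is isometric to `K_{w*,w}(X*, lip_τ(M))`. -/
noncomputable def toOpEquiv [BoundedSpace M] [CompleteSpace X] (hc : @CompactSpace M τ) :
    lipTau o X τ ≃ₗᵢ[ℝ] compactWeakStarWeak X (lipTau o ℝ τ) :=
  LinearIsometryEquiv.ofSurjective
    { toFun := fun f => ⟨toOp f, toOp_mem hc f⟩
      map_add' := fun f g => Subtype.ext <| ContinuousLinearMap.ext fun φ =>
        Subtype.ext <| Lip.ext fun x => map_add φ _ _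
      map_smul' := fun c f => Subtype.ext <| ContinuousLinearMap.ext fun φ =>
        Subtype.ext <| Lip.ext fun x => map_smul φ _ _
      norm_map' := norm_toOp } fun T => by
    obtain ⟨f, hf⟩ := exists_toOp_eq T.2
    exact ⟨f, Subtype.ext hf⟩

end Operators

theorem exists_eq_sum_of_finiteDimensional_range {Y : Type*} [NormedAddCommGroup Y]
    [NormedSpace ℝ Y] (S : Y →L[ℝ] Y) (hS : FiniteDimensional ℝ S.range) :
    ∃ (n : ℕ) (l : Fin n → StrongDual ℝ Y) (e : Fin n → Y), ∀ y, S y = ∑ i, l i y • e i := by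
  let b := Module.finBasis ℝ S.range
  refine ⟨_, fun i => (LinearMap.toContinuousLinearMap (b.coord i)).comp
    (S.codRestrict S.range fun y => LinearMap.mem_range_self _ y), fun i => b i, fun y => ?_⟩
  have := congrArg S.range.subtype (b.sum_repr ⟨S y, LinearMap.mem_range_self S.toLinearMap y⟩)
  rw [map_sum] at this
  exact this.symm

/-! ### The injective tensor product. -/

section Tensor

variable {M : Type*} [MetricSpace M] {o : M} {X : Type*} [NormedAddCommGroup X] [NormedSpace ℝ X]
  {τ : TopologicalSpace M}

variable (o X τ) in
/-- The map `lip_τ(M) ⊗ X → lip_τ(M, X)` sending `g ⊗ x` to `m ↦ g m • x`. -/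
noncomputable def tensorMap : AlgTensor (lipTau o ℝ τ) X →ₗ[ℝ] lipTau o X τ :=
  show (lipTau o ℝ τ) ⊗[ℝ] X →ₗ[ℝ] lipTau o X τ from
    TensorProduct.lift <| LinearMap.mk₂ ℝ
      (fun g x => ⟨Lip.postcomp (ContinuousLinearMap.toSpanSingleton ℝ x) g.1,
        Lip.postcomp_mem _ g.2⟩)
      (fun g h x => Subtype.ext <| Lip.ext fun m => add_smul (g.1 m) (h.1 m) x)
      (fun c g x => Subtype.ext <| Lip.ext fun m => mul_smul c (g.1 m) x)
      (fun g x y => Subtype.ext <| Lip.ext fun m => smul_add (g.1 m) x y)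
      (fun c g x => Subtype.ext <| Lip.ext fun m => smul_comm (g.1 m) c x)

theorem toOp_add (f g : lipTau o X τ) : toOp (f + g) = toOp f + toOp g :=
  ContinuousLinearMap.ext fun φ => Subtype.ext <| Lip.ext fun _ => map_add φ _ _

theorem toOp_sub (f g : lipTau o X τ) : toOp (f - g) = toOp f - toOp g :=
  ContinuousLinearMap.ext fun φ => Subtype.ext <| Lip.ext fun _ => map_sub φ _ _

theorem toOp_tensorMap_tmul (g : lipTau o ℝ τ) (x : X) (ψ : StrongDual ℝ X) :
    toOp (tensorMap o X τ (g ⊗ₜ[ℝ] x)) ψ = ψ x • g :=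
  Subtype.ext <| Lip.ext fun m => by
    change ψ (g.1 m • x) = ψ x * g.1 m
    rw [map_smul, smul_eq_mul, mul_comm]

/-- Matches the bilinear form defining the injective norm with the operator, so the two norms can be
compared by duality. -/
theorem apply_toOp_tensorMap (u : AlgTensor (lipTau o ℝ τ) X)
    (φ : StrongDual ℝ (lipTau o ℝ τ)) (ψ : StrongDual ℝ X) :
    φ (toOp (tensorMap o X τ u) ψ) = tensorToBilin (lipTau o ℝ τ) X u φ ψ := by
  refine TensorProduct.induction_on (motive := fun u =>
    φ (toOp (tensorMap o X τ u) ψ) = tensorToBilin (lipTau o ℝ τ) X u φ ψ) u ?_ ?_ ?_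
  · have h0 : tensorMap o X τ (0 : lipTau o ℝ τ ⊗[ℝ] X) = 0 := map_zero (tensorMap o X τ)
    have h1 : toOp (0 : lipTau o X τ) ψ = 0 := Subtype.ext <| Lip.ext fun _ => map_zero ψ
    rw [h0, h1, map_zero, map_zero]
    rfl
  · intro g x
    rw [toOp_tensorMap_tmul, tensorToBilin_tmul, map_smul, smul_eq_mul, mul_comm]
  · intro u v hu hv
    have h : tensorMap o X τ (u + v) = tensorMap o X τ u + tensorMap o X τ v :=
      map_add (tensorMap o X τ) u v
    rw [h, toOp_add, map_add, _root_.add_apply, map_add, hu, hv]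
    rfl

theorem norm_tensorMap (u : AlgTensor (lipTau o ℝ τ) X) : ‖tensorMap o X τ u‖ = ‖u‖ := by
  rw [← norm_toOp]
  change _ = ‖tensorToBilin (lipTau o ℝ τ) X u‖
  refine le_antisymm ?_ ?_
  · refine ContinuousLinearMap.opNorm_le_bound _ (norm_nonneg _) fun ψ => ?_
    refine NormedSpace.norm_le_dual_bound ℝ _ (by positivity) fun φ => ?_
    rw [apply_toOp_tensorMap]
    exact (ContinuousLinearMap.le_opNorm₂ _ φ ψ).trans_eq (by ring)
  · refine ContinuousLinearMap.opNorm_le_bound₂ _ (norm_nonneg _) fun φ ψ => ?_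
    rw [← apply_toOp_tensorMap]
    calc ‖φ (toOp (tensorMap o X τ u) ψ)‖ ≤ ‖φ‖ * ‖toOp (tensorMap o X τ u) ψ‖ := φ.le_opNorm _
      _ ≤ ‖φ‖ * (‖toOp (tensorMap o X τ u)‖ * ‖ψ‖) :=
        mul_le_mul_of_nonneg_left (ContinuousLinearMap.le_opNorm _ _) (norm_nonneg _)
      _ = _ := by ring

theorem exists_tensorMap_of_hasAP_lipTau [CompleteSpace X] (hc : @CompactSpace M τ)
    (hAP : HasAP (lipTau o ℝ τ)) (f : lipTau o X τ) {ε : ℝ} (hε : 0 < ε) :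
    ∃ u, ‖f - tensorMap o X τ u‖ ≤ ε := by
  obtain ⟨K, hK, hKT⟩ :=
    (isCompactOperator_toOp hc f).image_closedBall_subset_compact (f := (toOp f).toLinearMap) 1
  obtain ⟨S, hS, hSK⟩ := hAP K hK ε hε
  obtain ⟨n, l, e, hle⟩ := exists_eq_sum_of_finiteDimensional_range S hS
  -- Since `l i ∘ toOp f` is evaluation at `x i`, the finite-rank operator `S ∘ toOp f` comes from
  -- the tensor `∑ e i ⊗ x i`.
  choose x hx using fun i => exists_apply_toOp_eq hc f (l i)
  let u : AlgTensor (lipTau o ℝ τ) X := ∑ i, (show AlgTensor (lipTau o ℝ τ) X from e i ⊗ₜ[ℝ] x i)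
  have hu : ∀ φ, toOp (tensorMap o X τ u) φ = S (toOp f φ) := by
    intro φ
    have h1 : toOp (tensorMap o X τ u) = ∑ i, toOp (tensorMap o X τ (e i ⊗ₜ[ℝ] x i)) := by
      rw [show tensorMap o X τ u = _ from map_sum (tensorMap o X τ) _ _]
      exact map_sum (AddMonoidHom.mk' toOp toOp_add) _ _
    rw [h1, hle, _root_.sum_apply]
    exact Finset.sum_congr rfl fun i _ => by rw [toOp_tensorMap_tmul, hx]
  refine ⟨u, ?_⟩
  rw [← norm_toOp, toOp_sub]
  refine ContinuousLinearMap.opNorm_le_of_unit_norm hε.le fun φ hφ => ?_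
  rw [_root_.sub_apply, hu]
  exact (hSK _ (hKT ⟨φ, by simpa using hφ.le, rfl⟩)).le

/-- The difference quotients of `f ∈ lip_τ(M, X)` form a relatively compact set. -/
theorem totallyBounded_differenceQuotients (hc : @CompactSpace M τ) (f : lipTau o X τ) :
    TotallyBounded (range fun p : M × M => (dist p.1 p.2)⁻¹ • (f.1 p.1 - f.1 p.2)) := by
  refine Metric.totallyBounded_iff.2 fun ε hε => ?_
  obtain ⟨δ, hδ, hf⟩ := mem_littleLip_iff.1 f.2.1 (ε / 2) (half_pos hε)
  have hr := isCompact_range_of_mem_lipTau hc f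
  have hK : IsCompact ((fun q : ℝ × X × X => q.1 • (q.2.1 - q.2.2)) ''
      (Icc 0 δ⁻¹ ×ˢ range (f.1 : M → X) ×ˢ range (f.1 : M → X))) :=
    (isCompact_Icc.prod (hr.prod hr)).image (by fun_prop)
  obtain ⟨t, ht, hcov⟩ := Metric.totallyBounded_iff.1 hK.totallyBounded ε hε
  -- The centre 0 covers the quotients of pairs closer than `δ`, including the diagonal, where the
  -- quotient is 0; the net `t` covers the rest.
  refine ⟨insert 0 t, ht.insert 0, ?_⟩
  rintro _ ⟨⟨x, y⟩, rfl⟩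
  rcases lt_or_ge (dist x y) δ with hd | hd
  · refine mem_iUnion₂.2 ⟨0, mem_insert _ _, ?_⟩
    rw [mem_ball_zero_iff, norm_smul, norm_inv, Real.norm_of_nonneg dist_nonneg, ← div_eq_inv_mul]
    exact (div_le_of_le_mul₀ dist_nonneg (half_pos hε).le (hf x y hd)).trans_lt
      (half_lt_self hε)
  · obtain ⟨z, hz, hxz⟩ := mem_iUnion₂.1 (hcov ⟨((dist x y)⁻¹, f.1 x, f.1 y),
      ⟨⟨inv_nonneg.2 dist_nonneg, inv_anti₀ hδ hd⟩, mem_range_self x, mem_range_self y⟩, rfl⟩)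
    exact mem_iUnion₂.2 ⟨z, mem_insert_of_mem _ hz, hxz⟩

/-- The Lipschitz norm of `f - S ∘ f` is the supremum of `‖q - S q‖` over the difference quotients
`q` of `f`, so `S` need only approximate the identity on their compact closure. -/
theorem exists_tensorMap_of_hasAP [CompleteSpace X] (hc : @CompactSpace M τ)
    (hAP : HasAP X) (f : lipTau o X τ) {ε : ℝ} (hε : 0 < ε) :
    ∃ u, ‖f - tensorMap o X τ u‖ ≤ ε := by
  obtain ⟨S, hS, hSK⟩ := hAP _
    ((totallyBounded_differenceQuotients hc f).closure.isCompact_of_isClosed isClosed_closure)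
    ε hε
  obtain ⟨n, l, e, hle⟩ := exists_eq_sum_of_finiteDimensional_range S hS
  let u : AlgTensor (lipTau o ℝ τ) X :=
    ∑ i, (show AlgTensor (lipTau o ℝ τ) X from toOp f (l i) ⊗ₜ[ℝ] e i)
  have hu : ∀ m, (tensorMap o X τ u).1 m = S (f.1 m) := by
    intro m
    rw [hle, show tensorMap o X τ u = _ from map_sum (tensorMap o X τ) _ _]
    exact map_sum ((Lip.eval m).comp (lipTau o X τ).subtypeL) _ _
  refine ⟨u, Lip.norm_le hε.le fun x y => ?_⟩
  change ‖(f.1 x - (tensorMap o X τ u).1 x) - (f.1 y - (tensorMap o X τ u).1 y)‖ ≤ _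
  rcases eq_or_ne x y with rfl | hne
  · simp
  have hd : 0 < dist x y := dist_pos.2 hne
  have hq := (hSK _ (subset_closure (mem_range_self (x, y)))).le
  have h : (f.1 x - (tensorMap o X τ u).1 x) - (f.1 y - (tensorMap o X τ u).1 y) =
      dist x y • ((dist x y)⁻¹ • (f.1 x - f.1 y) - S ((dist x y)⁻¹ • (f.1 x - f.1 y))) := by
    rw [map_smul, ← smul_sub, smul_inv_smul₀ hd.ne', hu, hu, map_sub]
    abel
  rw [h, norm_smul, Real.norm_of_nonneg hd.le, mul_comm]
  exact mul_le_mul_of_nonneg_right hq hd.le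

theorem denseRange_tensorMap [CompleteSpace X] (hc : @CompactSpace M τ)
    (hAP : HasAP (lipTau o ℝ τ) ∨ HasAP X) : DenseRange (tensorMap o X τ) := by
  refine Metric.denseRange_iff.2 fun f ε hε => ?_
  obtain ⟨u, hu⟩ : ∃ u, ‖f - tensorMap o X τ u‖ ≤ ε / 2 := hAP.elim
    (fun h => exists_tensorMap_of_hasAP_lipTau hc h f (half_pos hε))
    (fun h => exists_tensorMap_of_hasAP hc h f (half_pos hε))
  exact ⟨u, by rw [dist_eq_norm]; linarith⟩

/-- Under the approximation property of `lip_τ(M)` or `X`, the space `lip_τ(M, X)` is isometric to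
the injective tensor product of `lip_τ(M)` and `X`. -/
noncomputable def injectiveTensorEquiv [BoundedSpace M] [CompleteSpace X]
    (hc : @CompactSpace M τ) (hAP : HasAP (lipTau o ℝ τ) ∨ HasAP X) :
    lipTau o X τ ≃ₗᵢ[ℝ] InjectiveTensor (lipTau o ℝ τ) X :=
  -- `tensorMap` and the completion embedding are norm-preserving with dense range in complete
  -- spaces, so the identity of the algebraic tensor product extends.
  (LinearEquiv.refl ℝ (AlgTensor (lipTau o ℝ τ) X)).extendOfIsometry (tensorMap o X τ)
    (UniformSpace.Completion.toComplₗᵢ (𝕜 := ℝ)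
      (E := AlgTensor (lipTau o ℝ τ) X)).toLinearMap
    (denseRange_tensorMap hc hAP) UniformSpace.Completion.denseRange_coe fun u =>
      (UniformSpace.Completion.norm_coe u).trans (norm_tensorMap u).symm

end Tensor

end LipTau

theorem mainTheorem3 {M : Type*} [MetricSpace M] [BoundedSpace M] (o : M)
    {X : Type*} [NormedAddCommGroup X] [NormedSpace ℝ X] [CompleteSpace X]
    (τ : TopologicalSpace M) (hcompact : @CompactSpace M τ)
    (hlsc : @LowerSemicontinuous (M × M) ℝ (@instTopologicalSpaceProd M M τ τ) _
      (fun p => dist p.1 p.2)) :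
    Nonempty (LipTau.lipTau o X τ ≃ₗᵢ[ℝ]
      LipTau.compactWeakStarWeak X (LipTau.lipTau o ℝ τ)) ∧
    (LipTau.HasAP (LipTau.lipTau o ℝ τ) ∨ LipTau.HasAP X →
      Nonempty (LipTau.lipTau o X τ ≃ₗᵢ[ℝ]
        LipTau.InjectiveTensor (LipTau.lipTau o ℝ τ) X)) := by
  exact ⟨⟨LipTau.toOpEquiv hcompact⟩, fun hAP => ⟨LipTau.injectiveTensorEquiv hcompact hAP⟩⟩
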